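/- Let $k$ be a field of characteristic zero, $n\ge 0$, $S=k[y_1,\dots,y_n]$, and let $\succ$ be the graded reverse lexicographic order on monomials with $y_n\succ\cdots\succ y_1$ (so $m\succ m'$ iff $\deg m>\deg m'$, or the degrees agree and, for the smallest $j$ at which the exponents of $y_j$ in $m$ and $m'$ differ, that in $m$ is the smaller one). Put $[i]=\{1,\dots,i\}$, $[0]=\emptyset$, and for $\sigma\subseteq[n]$ let $\mathbb N^{\sigma}$ be the set of monomials in the variables $y_j$, $j\in\sigma$. Let $u\in GL_n(k)$ act on $S$ by $y_i\mapsto\sum_j u_{ij}y_j$. A monomial ideal $M$ of $S$ has as admissible pairs the sets $m\mathbb N^{\sigma}$, with $\sigma\subseteq[n]$ and $m\in\mathbb N^{[n]\setminus\sigma}$, that contain no element of $M$; its standard pairs are the admissible pairs that are maximal under inclusion. For any ideal $I\subseteq S$ there is exactly one ideal $\mathrm{Gin}(I)$ such that $\mathrm{In}_\succ(uI)=\mathrm{Gin}(I)$ for all $u$ in some nonempty Zariski open subset of $GL_n(k)$. Let $U\subseteq GL_n(k)$ be any nonempty Zariski open set on which $\mathrm{In}_\succ(uI)$ does not depend on $u$,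 let $u\in U$, and set $$B(I)=\{m\in\mathbb N^{[n]} : m\notin \mathrm{span}_k(\{m'\in\mathbb N^{[n]} : m\succ m'\}\cup uI)\},$$ $$A_i(I)=\{m\in\mathbb N^{\{i+1,\dots,n\}} : m\,\mathbb N^{\{i\}}\subseteq B(I),\ m\,\mathbb N^{\{i+1\}}\not\subseteq B(I)\}\qquad(0\le i\le n),$$ where for $i=0$ the condition $m\,\mathbb N^{\{0\}}\subseteq B(I)$ is read as $m\in B(I)$, and for $i=n$ the condition $m\,\mathbb N^{\{n+1\}}\not\subseteq B(I)$ is regarded as always satisfied. Then the set of standard pairs of $\mathrm{Gin}(I)$ is $$\{a\,\mathbb N^{[i]} : 0\le i\le n,\ a\in A_i(I)\}.$$ -/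

import Mathlib

/-! Monomials of `S = k[y_1, …, y_n]` are the exponent vectors `Fin n →₀ ℕ`, written additively;
the variable `y_{j+1}` is `X j` for `j : Fin n` (so the values of `j` run over `0, …, n-1`). -/

namespace StdPairs

section MonomialOrders

/-- Type synonym of the monoid of monomials, to carry the reverse lexicographic order. -/
def RevLexSyn (n : ℕ) : Type := Fin n →₀ ℕ

noncomputable instance (n : ℕ) : AddCommMonoid (RevLexSyn n) :=
  inferInstanceAs (AddCommMonoid (Fin n →₀ ℕ))

/-- The identity map from monomials to the type synonym. -/
noncomputable def toRevLex (n : ℕ) : (Fin n →₀ ℕ) ≃+ RevLexSyn n where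
  toFun a := a
  invFun a := a
  left_inv _ := rfl
  right_inv _ := rfl
  map_add' _ _ := rfl

/-- The key by which monomials are compared: first the degree, then the exponent vector in the
dual of the lexicographic order. -/
noncomputable def revLexKey (n : ℕ) (a : RevLexSyn n) : ℕ ×ₗ (Lex (Fin n →₀ ℕ))ᵒᵈ :=
  toLex (((toRevLex n).symm a).degree, OrderDual.toDual (toLex ((toRevLex n).symm a)))

theorem revLexKey_injective (n : ℕ) : Function.Injective (revLexKey n) := by
  intro a b h
  have h2 := congrArg (fun p => (ofLex p).2) h
  exact (toRevLex n).symm.injective (toLex.injective (OrderDual.toDual.injective h2))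

noncomputable instance (n : ℕ) : LinearOrder (RevLexSyn n) :=
  LinearOrder.lift' (revLexKey n) (revLexKey_injective n)

theorem toRevLex_le_iff {n : ℕ} {a b : Fin n →₀ ℕ} :
    toRevLex n a ≤ toRevLex n b ↔
      a.degree < b.degree ∨ (a.degree = b.degree ∧ toLex b ≤ toLex a) :=
  Prod.Lex.le_iff (x := revLexKey n (toRevLex n a)) (y := revLexKey n (toRevLex n b))

theorem toRevLex_lt_iff {n : ℕ} {a b : Fin n →₀ ℕ} :
    toRevLex n a < toRevLex n b ↔
      a.degree < b.degree ∨ (a.degree = b.degree ∧ toLex b < toLex a) :=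
  Prod.Lex.lt_iff (x := revLexKey n (toRevLex n a)) (y := revLexKey n (toRevLex n b))

instance (n : ℕ) : IsOrderedAddMonoid (RevLexSyn n) where
  add_le_add_left a b h c := by
    obtain ⟨a, rfl⟩ := (toRevLex n).surjective a
    obtain ⟨b, rfl⟩ := (toRevLex n).surjective b
    obtain ⟨c, rfl⟩ := (toRevLex n).surjective c
    rw [← map_add, ← map_add, toRevLex_le_iff, map_add, map_add]
    rcases toRevLex_le_iff.1 h with h' | ⟨h1, h2⟩
    · left; omega
    · right
      exact ⟨by omega, add_le_add_left h2 (toLex c)⟩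

theorem toRevLex_monotone (n : ℕ) : Monotone (toRevLex n) := by
  intro a b h
  obtain ⟨c, rfl⟩ := exists_add_of_le h
  rw [toRevLex_le_iff, map_add]
  rcases Nat.eq_zero_or_pos c.degree with hc | hc
  · right
    have : c = 0 := (Finsupp.degree_eq_zero_iff c).1 hc
    simp [this]
  · left; omega

instance (n : ℕ) : WellQuasiOrderedLE (RevLexSyn n) where
  wqo f := by
    obtain ⟨i, j, hij, h⟩ := (Finsupp.wellQuasiOrderedLE (α := ℕ) (σ := Fin n)).wqo
      fun i => (toRevLex n).symm (f i)
    exact ⟨i, j, hij, toRevLex_monotone n h⟩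

/-- The (graded) reverse lexicographic order on the monomials in `y_1, …, y_n`,
with `y_n ≻ ⋯ ≻ y_1`. -/
noncomputable def revLex (n : ℕ) : MonomialOrder (Fin n) where
  syn := RevLexSyn n
  toSyn := toRevLex n
  toSyn_monotone := toRevLex_monotone n

/-- `a ≺ b` iff `a` has smaller degree, or the degrees agree and at the smallest index where
`a` and `b` differ the exponent of `a` is the larger one. -/
theorem revLex_lt_iff {n : ℕ} {a b : Fin n →₀ ℕ} :
    (revLex n).toSyn a < (revLex n).toSyn b ↔
      a.degree < b.degree ∨
        (a.degree = b.degree ∧ ∃ j, (∀ l < j, a l = b l) ∧ b j < a j) := by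
  refine (toRevLex_lt_iff (a := a) (b := b)).trans ?_
  rw [Finsupp.Lex.lt_iff]
  simp only [eq_comm, ofLex_toLex]

end MonomialOrders

section InitialIdeals

variable {k : Type*} [Field k] {n : ℕ}

/-- The initial ideal `In_≻(J)`, generated by the leading terms of the elements of `J`. -/
noncomputable def initialIdeal (J : Ideal (MvPolynomial (Fin n) k)) :
    Ideal (MvPolynomial (Fin n) k) :=
  Ideal.span ((revLex n).leadingTerm '' (J : Set (MvPolynomial (Fin n) k)))

/-- The action on `S` of a linear change of coordinates `u`: `y_i ↦ ∑ j, u_{ij} y_j`. -/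
noncomputable def linSubst (u : GL (Fin n) k) :
    MvPolynomial (Fin n) k →ₐ[k] MvPolynomial (Fin n) k :=
  MvPolynomial.aeval fun i =>
    ∑ j : Fin n, MvPolynomial.C ((u : Matrix (Fin n) (Fin n) k) i j) * MvPolynomial.X j

/-- The ideal `uI`. Since `linSubst u` is an automorphism this is the image of `I`. -/
noncomputable def transform (u : GL (Fin n) k) (I : Ideal (MvPolynomial (Fin n) k)) :
    Ideal (MvPolynomial (Fin n) k) :=
  I.map (linSubst u)

/-- Zariski open subsets of `GL_n(k)`: those cut out by the non-vanishing of some member of a set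
of polynomials in the matrix entries. -/
def IsZariskiOpen (U : Set (GL (Fin n) k)) : Prop :=
  ∃ F : Set (MvPolynomial (Fin n × Fin n) k), U =
    {u : GL (Fin n) k | ∃ p ∈ F, MvPolynomial.eval
      (fun ij : Fin n × Fin n => (u : Matrix (Fin n) (Fin n) k) ij.1 ij.2) p ≠ 0}

/-- `U` is a nonempty Zariski open set of linear changes of coordinates over which the initial
ideal of `uI` does not depend on `u`. That constant initial ideal is `Gin(I)`. -/
def IsGenericLocus (I : Ideal (MvPolynomial (Fin n) k)) (U : Set (GL (Fin n) k)) : Prop :=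
  IsZariskiOpen U ∧ U.Nonempty ∧
    ∀ u ∈ U, ∀ v ∈ U, initialIdeal (transform u I) = initialIdeal (transform v I)

/-- `G` is the generic initial ideal `Gin(I)` of `I`: it is the initial ideal of `uI` for all `u`
in some nonempty Zariski open set. -/
def IsGin (I G : Ideal (MvPolynomial (Fin n) k)) : Prop :=
  ∃ U : Set (GL (Fin n) k), IsGenericLocus I U ∧ ∀ u ∈ U, initialIdeal (transform u I) = G

/-- The monomials that are not in the linear span of the `≺`-smaller monomials together with `J`.
For `J = uI` with `u` generic this is `B(I)`. -/
def basisMonomials (J : Ideal (MvPolynomial (Fin n) k)) : Set (Fin n →₀ ℕ) :=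
  {m | MvPolynomial.monomial m (1 : k) ∉
    Submodule.span k
      ({f | ∃ m', (revLex n).toSyn m' < (revLex n).toSyn m ∧ f = MvPolynomial.monomial m' 1} ∪
        (J : Set (MvPolynomial (Fin n) k)))}

/-- The standard monomials of `M`: those not lying in `M`. -/
def standardMonomials (M : Ideal (MvPolynomial (Fin n) k)) : Set (Fin n →₀ ℕ) :=
  {m | MvPolynomial.monomial m (1 : k) ∉ M}

end InitialIdeals

section Pairs

variable {n : ℕ}

/-- `a ℕ^σ`: the products of `a` with the monomials in the variables indexed by `σ`. -/
def cone (a : Fin n →₀ ℕ) (σ : Set (Fin n)) : Set (Fin n →₀ ℕ) :=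
  {m | ∃ c : Fin n →₀ ℕ, (c.support : Set (Fin n)) ⊆ σ ∧ m = a + c}

/-- The set `[i] = {1, …, i}` of indices of variables. -/
def initSeg (n i : ℕ) : Set (Fin n) := {j | (j : ℕ) + 1 ≤ i}

/-- The set `{i}` of indices of variables; it is empty if there is no variable `y_i`. -/
def singleIdx (n i : ℕ) : Set (Fin n) := {j | (j : ℕ) + 1 = i}

/-- The set `A_i` attached to a set `B` of monomials: monomials `m` in `y_{i+1}, …, y_n` with
`m ℕ^{i} ⊆ B` (for `i = 0` this reads `m ∈ B`) and `m ℕ^{i+1} ⊄ B`; the latter is automatic for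
`i = n`, as `y_{n+1}` is not a variable of `S`. -/
def monomialSet (B : Set (Fin n →₀ ℕ)) (i : ℕ) : Set (Fin n →₀ ℕ) :=
  {m | (∀ j ∈ m.support, i + 1 ≤ (j : ℕ) + 1) ∧
    cone m (singleIdx n i) ⊆ B ∧ (i < n → ¬ cone m (singleIdx n (i + 1)) ⊆ B)}

/-- Admissible pairs of the monomial ideal `M`: sets `m ℕ^σ` of standard monomials of `M` such that
no variable with index in `σ` divides `m`. -/
def IsAdmissiblePair {k : Type*} [Field k] (M : Ideal (MvPolynomial (Fin n) k))
    (P : Set (Fin n →₀ ℕ)) : Prop :=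
  ∃ (m : Fin n →₀ ℕ) (σ : Set (Fin n)), Disjoint (m.support : Set (Fin n)) σ ∧
    P = cone m σ ∧ P ⊆ standardMonomials M

/-- Standard pairs: admissible pairs that are maximal under inclusion. -/
def IsStandardPair {k : Type*} [Field k] (M : Ideal (MvPolynomial (Fin n) k))
    (P : Set (Fin n →₀ ℕ)) : Prop :=
  Maximal (IsAdmissiblePair M) P

end Pairs

end StdPairs

/-! Writing `m` outside the span of the smaller monomials and `uI` means that `m` is not a leading
monomial of `uI`. So `B(I)` is the set of standard monomials of `Gin(I)`. In characteristic zero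
`Gin(I)` is strongly stable: if it contains `m * y_j` and `j < l`, it contains `m * y_l`. Hence
`B(I)` is closed under divisors and under replacing `y_l` by `y_j`, and `m ℕ^{i} ⊆ B(I)` forces `m
ℕ^[i] ⊆ B(I)`. The directions of a maximal pair therefore form some `[i]`, and the conditions
defining `A_i` express maximality.

Existence of `Gin(I)` and strong stability both rest on counting. As `I` need not be homogeneous,
the counts use upper sets `T` of monomials of one degree `d`: a polynomial of degree at most `d`
with a nonzero coefficient in `T` has its leading monomial in `T`. A nonvanishing minor on `T` thus
bounds the number of leading monomials in `T` from below (`card_le_card_leadIn`). This number is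
lower semicontinuous in `u`, so it is maximal on a nonempty open set. If stability failed, a
diagonal scaling followed by a shear would exceed the maximum
(`IsGenericLocus.add_single_mem_leadSet`). -/

namespace StdPairs

open MvPolynomial

/-! ### Leading monomials and standard monomials. -/

section LeadingMonomials

variable {k : Type*} [Field k] {n : ℕ}

/-- The leading monomials of the nonzero elements of `J`. -/
def leadSet (J : Ideal (MvPolynomial (Fin n) k)) : Set (Fin n →₀ ℕ) :=
  {m | ∃ f ∈ J, f ≠ 0 ∧ (revLex n).degree f = m}

theorem exists_monic_of_mem_leadSet {J : Ideal (MvPolynomial (Fin n) k)} {m : Fin n →₀ ℕ}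
    (hm : m ∈ leadSet J) :
    ∃ f ∈ J, (revLex n).degree f = m ∧ coeff m f = 1 := by
  obtain ⟨f, hf, hf0, rfl⟩ := hm
  have hc : (revLex n).leadingCoeff f ≠ 0 := (revLex n).leadingCoeff_ne_zero_iff.2 hf0
  refine ⟨C ((revLex n).leadingCoeff f)⁻¹ * f, J.mul_mem_left _ hf, ?_, ?_⟩
  · rw [(revLex n).degree_mul (by simpa using hc) hf0]
    simp
  · rw [coeff_C_mul]
    exact inv_mul_cancel₀ hc

theorem add_mem_leadSet {J : Ideal (MvPolynomial (Fin n) k)} {m : Fin n →₀ ℕ}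
    (hm : m ∈ leadSet J) (c : Fin n →₀ ℕ) : m + c ∈ leadSet J := by
  classical
  obtain ⟨f, hf, hf0, rfl⟩ := hm
  have h1 : monomial c (1 : k) ≠ 0 := by simp
  refine ⟨f * monomial c 1, J.mul_mem_right _ hf, mul_ne_zero hf0 h1, ?_⟩
  rw [(revLex n).degree_mul hf0 h1, (revLex n).degree_monomial]
  simp

theorem mem_leadSet_of_le {J : Ideal (MvPolynomial (Fin n) k)} {m m' : Fin n →₀ ℕ}
    (hm : m ∈ leadSet J) (h : m ≤ m') : m' ∈ leadSet J := by
  obtain ⟨c, rfl⟩ := exists_add_of_le h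
  exact add_mem_leadSet hm c

theorem initialIdeal_eq (J : Ideal (MvPolynomial (Fin n) k)) :
    initialIdeal J = Ideal.span ((fun m => monomial m (1 : k)) '' leadSet J) := by
  rw [initialIdeal, (revLex n).span_leadingTerm_eq_span_monomial']
  congr 1
  ext p
  simp only [Set.mem_image, leadSet, Set.mem_ofPred_eq]
  constructor
  · rintro ⟨f, ⟨hf, hf0⟩, rfl⟩
    exact ⟨_, ⟨f, hf, hf0, rfl⟩, rfl⟩
  · rintro ⟨_, ⟨f, hf, hf0, rfl⟩, rfl⟩
    exact ⟨f, ⟨hf, hf0⟩, rfl⟩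

theorem monomial_mem_initialIdeal_iff {J : Ideal (MvPolynomial (Fin n) k)} {m : Fin n →₀ ℕ} :
    monomial m (1 : k) ∈ initialIdeal J ↔ m ∈ leadSet J := by
  classical
  rw [initialIdeal_eq, mem_ideal_span_monomial_image]
  simp only [support_monomial, one_ne_zero, if_false, Finset.mem_singleton, forall_eq]
  exact ⟨fun ⟨s, hs, h⟩ => mem_leadSet_of_le hs h, fun h => ⟨m, h, le_rfl⟩⟩

theorem initialIdeal_eq_iff {J J' : Ideal (MvPolynomial (Fin n) k)} :
    initialIdeal J = initialIdeal J' ↔ leadSet J = leadSet J' := by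
  constructor
  · intro h
    ext m
    rw [← monomial_mem_initialIdeal_iff, h, monomial_mem_initialIdeal_iff]
  · intro h
    rw [initialIdeal_eq, initialIdeal_eq, h]

theorem standardMonomials_initialIdeal (J : Ideal (MvPolynomial (Fin n) k)) :
    standardMonomials (initialIdeal J) = (leadSet J)ᶜ := by
  ext m
  exact not_congr monomial_mem_initialIdeal_iff

theorem mem_span_smaller_iff {m : Fin n →₀ ℕ} {f : MvPolynomial (Fin n) k} :
    f ∈ Submodule.span k {f : MvPolynomial (Fin n) k |
        ∃ m', (revLex n).toSyn m' < (revLex n).toSyn m ∧ f = monomial m' 1} ↔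
      ∀ m' ∈ f.support, (revLex n).toSyn m' < (revLex n).toSyn m := by
  classical
  constructor
  · intro h
    induction h using Submodule.span_induction with
    | mem x hx =>
      obtain ⟨m', hm', rfl⟩ := hx
      simpa [support_monomial] using hm'
    | zero => simp
    | add x y _ _ hx hy =>
      intro m' hm'
      rcases Finset.mem_union.1 (support_add hm') with h | h
      exacts [hx _ h, hy _ h]
    | smul a x _ hx => exact fun m' hm' => hx m' (support_smul hm')
  · intro h
    rw [f.as_sum]
    refine Submodule.sum_mem _ fun m' hm' => ?_
    have : monomial m' (coeff m' f) = coeff m' f • monomial m' (1 : k) := by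
      simp [smul_monomial]
    rw [this]
    exact Submodule.smul_mem _ _ (Submodule.subset_span ⟨m', h m' hm', rfl⟩)

/-- Expressing `m` as smaller monomials plus some `f ∈ J` is the same as giving a monic `f ∈ J` with
leading monomial `m`. -/
theorem basisMonomials_eq (J : Ideal (MvPolynomial (Fin n) k)) :
    basisMonomials J = (leadSet J)ᶜ := by
  classical
  ext m
  refine not_congr ?_
  have hJ : Submodule.span k (J : Set (MvPolynomial (Fin n) k)) = J.restrictScalars k :=
    Submodule.span_eq (J.restrictScalars k)
  rw [Submodule.span_union, hJ, Submodule.mem_sup]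
  constructor
  · rintro ⟨s, hs, f, hf, hsf⟩
    rw [mem_span_smaller_iff] at hs
    have hcoeff : ∀ a, ¬ (revLex n).toSyn a < (revLex n).toSyn m →
        coeff a f = coeff a (monomial m (1 : k)) := by
      intro a ha
      rw [← hsf, coeff_add, notMem_support_iff.1 fun h => ha (hs a h), zero_add]
    have hm1 : coeff m f = 1 := by rw [hcoeff m (lt_irrefl _)]; simp
    refine ⟨f, hf, fun h => by simp [h] at hm1, ?_⟩
    apply (revLex n).toSyn.injective
    apply le_antisymm
    · rw [(revLex n).degree_le_iff]
      intro a ha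
      by_contra hlt
      rw [not_le] at hlt
      have h1 := hcoeff a (not_lt.2 hlt.le)
      rw [coeff_monomial, if_neg (by rintro rfl; exact lt_irrefl _ hlt)] at h1
      exact mem_support_iff.1 ha h1
    · exact (revLex n).le_degree (mem_support_iff.2 (by simp [hm1]))
  · intro hm
    obtain ⟨f, hf, hd, h1⟩ := exists_monic_of_mem_leadSet hm
    refine ⟨monomial m 1 - f, ?_, f, hf, by simp⟩
    rw [mem_span_smaller_iff]
    intro a ha
    have hne : a ≠ m := by
      rintro rfl
      exact mem_support_iff.1 ha (by simp [h1])
    have haf : a ∈ f.support := by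
      rw [mem_support_iff, coeff_sub, coeff_monomial, if_neg hne.symm, zero_sub, neg_ne_zero] at ha
      exact mem_support_iff.2 ha
    have := (revLex n).le_degree haf
    rw [hd] at this
    exact lt_of_le_of_ne this fun h => hne ((revLex n).toSyn.injective h)

theorem totalDegree_le_degree_degree (f : MvPolynomial (Fin n) k) :
    f.totalDegree ≤ ((revLex n).degree f).degree := by
  rw [totalDegree_eq]
  refine Finset.sup_le fun m hm => ?_
  have h := (revLex n).le_degree hm
  have h' : m.degree ≤ ((revLex n).degree f).degree := by
    rcases toRevLex_le_iff.1 h with h | h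
    · exact h.le
    · exact h.1.le
  simpa [Finsupp.degree_eq_sum, Finsupp.sum_fintype] using h'

end LeadingMonomials

/-! ### Minors bound the number of leading monomials. -/

section Counting

variable {k : Type*} [Field k] {n : ℕ}

/-- `T` is a set of monomials of degree `d` that contains with each monomial all bigger ones
of the same degree. -/
def IsUpperInDegree (d : ℕ) (T : Finset (Fin n →₀ ℕ)) : Prop :=
  ∀ w ∈ T, w.degree = d ∧
    ∀ w' : Fin n →₀ ℕ, w'.degree = d → (revLex n).toSyn w ≤ (revLex n).toSyn w' → w' ∈ T

open Classical in
/-- The leading monomials of elements of `J` that lie in `T`. -/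
noncomputable def leadIn (J : Ideal (MvPolynomial (Fin n) k)) (T : Finset (Fin n →₀ ℕ)) :
    Finset (Fin n →₀ ℕ) :=
  T.filter (· ∈ leadSet J)

theorem mem_leadIn {J : Ideal (MvPolynomial (Fin n) k)} {T : Finset (Fin n →₀ ℕ)}
    {m : Fin n →₀ ℕ} : m ∈ leadIn J T ↔ m ∈ T ∧ m ∈ leadSet J := by
  classical
  exact Finset.mem_filter

theorem degree_le_totalDegree {f : MvPolynomial (Fin n) k} {m : Fin n →₀ ℕ}
    (h : m ∈ f.support) : m.degree ≤ f.totalDegree := by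
  have := le_totalDegree h
  simpa [Finsupp.degree_eq_sum, Finsupp.sum_fintype] using this

/-- Elements of `J` of degree at most `d` whose coefficients at monomials of `T` form an
invertible matrix are at most as many as the leading monomials of `J` in `T`. -/
theorem card_le_card_leadIn {J : Ideal (MvPolynomial (Fin n) k)} {d : ℕ}
    {T : Finset (Fin n →₀ ℕ)} (hT : IsUpperInDegree d T) {ι : Type*} [Fintype ι] [DecidableEq ι]
    (f : ι → MvPolynomial (Fin n) k) (hf : ∀ i, f i ∈ J) (hd : ∀ i, (f i).totalDegree ≤ d)
    (e : ι → Fin n →₀ ℕ) (he : ∀ i, e i ∈ T)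
    (hdet : (Matrix.of fun i j => coeff (e j) (f i)).det ≠ 0) :
    Fintype.card ι ≤ (leadIn J T).card := by
  by_contra! hlt
  -- Sends `c` to the coefficients of `∑ c i * f i` at the leading monomials in `T`; there are fewer
  -- of these than polynomials, so the kernel is nonzero.
  let φ : (ι → k) →ₗ[k] ({x // x ∈ leadIn J T} → k) :=
    Matrix.vecMulLinear (Matrix.of fun i (x : {x // x ∈ leadIn J T}) => coeff x.1 (f i))
  have hker : LinearMap.ker φ ≠ ⊥ := by
    apply LinearMap.ker_ne_bot_of_finrank_lt
    simpa using hlt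
  obtain ⟨c, hc, hc0⟩ := (Submodule.ne_bot_iff _).1 hker
  set g : MvPolynomial (Fin n) k := ∑ i, C (c i) * f i with hg
  have hcoeff : ∀ m, coeff m g = ∑ i, c i * coeff m (f i) := by
    intro m
    simp [hg, coeff_sum, coeff_C_mul]
  have hgJ : g ∈ J := Ideal.sum_mem _ fun i _ => J.mul_mem_left _ (hf i)
  have hgd : g.totalDegree ≤ d := by
    refine totalDegree_finsetSum_le fun i _ => ?_
    refine (totalDegree_mul _ _).trans ?_
    simpa using hd i
  have hzero : ∀ m ∈ leadIn J T, coeff m g = 0 := by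
    intro m hm
    rw [hcoeff]
    exact congrFun (LinearMap.mem_ker.1 hc) ⟨m, hm⟩
  obtain ⟨j, hj⟩ : ∃ j, coeff (e j) g ≠ 0 := by
    by_contra! h
    refine hc0 (Matrix.eq_zero_of_vecMul_eq_zero hdet ?_)
    ext j
    rw [Pi.zero_apply, ← h j, hcoeff]
    rfl
  have hg0 : g ≠ 0 := fun h => hj (by simp [h])
  -- The leading monomial of `g` is at least `e j` and has degree `d`, so it lies in `T`, where the
  -- coefficients of `g` at leading monomials of `J` vanish.
  have hle := (revLex n).le_degree (mem_support_iff.2 hj)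
  have hdeg : ((revLex n).degree g).degree = d := by
    refine le_antisymm ((degree_le_totalDegree ((revLex n).degree_mem_support hg0)).trans hgd) ?_
    rw [← (hT _ (he j)).1]
    exact (degree_le_totalDegree (mem_support_iff.2 hj)).trans (totalDegree_le_degree_degree g)
  have hmem : (revLex n).degree g ∈ T := (hT _ (he j)).2 _ hdeg hle
  exact (revLex n).coeff_degree_ne_zero_iff.2 hg0 (hzero _ (mem_leadIn.2 ⟨hmem, g, hgJ, hg0, rfl⟩))

/-- A square matrix that is triangular for the order of the row labels `b`, with nonzero diagonal
entries, has nonzero determinant. -/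
theorem det_ne_zero_of_triangular {ι α : Type*} [Fintype ι] [DecidableEq ι] [LinearOrder α]
    (b : ι → α) (hb : Function.Injective b) (M : Matrix ι ι k)
    (hM : ∀ i j, M i j ≠ 0 → b i ≤ b j) (hd : ∀ i, M i i ≠ 0) : M.det ≠ 0 := by
  let _ : LinearOrder ι := LinearOrder.lift' b hb
  have h : M.BlockTriangular id := by
    intro i j hij
    by_contra hne
    exact absurd (hM i j hne) (not_le.2 hij)
  have := Matrix.det_of_isUpperTriangular h
  rw [show M.det = ∏ i, M i i by convert this]
  exact Finset.prod_ne_zero_iff.2 fun i _ => hd i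

end Counting

end StdPairs

namespace StdPairs

open MvPolynomial

/-! ### Linear changes of coordinates. -/

section LinearSubstitution

variable {k : Type*} [Field k] {n : ℕ}

theorem linSubst_X (u : GL (Fin n) k) (i : Fin n) :
    linSubst u (X i) = ∑ j : Fin n, C ((u : Matrix (Fin n) (Fin n) k) i j) * X j := by
  simp [linSubst]

/-- Images of variables are rows of the matrix, so the order is reversed: `u * v` substitutes by `u`
first. -/
theorem linSubst_mul (u v : GL (Fin n) k) :
    linSubst (u * v) = (linSubst v).comp (linSubst u) := by
  apply MvPolynomial.algHom_ext
  intro i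
  simp only [AlgHom.comp_apply, linSubst_X, map_sum, map_mul, algHom_C, Finset.mul_sum]
  rw [Finset.sum_comm]
  refine Finset.sum_congr rfl fun j _ => ?_
  rw [Units.val_mul, Matrix.mul_apply, map_sum, Finset.sum_mul]
  refine Finset.sum_congr rfl fun l _ => ?_
  rw [map_mul]
  simp [mul_assoc, MvPolynomial.algebraMap_eq]

theorem linSubst_one : linSubst (1 : GL (Fin n) k) = AlgHom.id k _ := by
  apply MvPolynomial.algHom_ext
  intro i
  rw [linSubst_X, Finset.sum_eq_single i]
  · simp
  · intro j _ hj
    simp [Matrix.one_apply_ne hj.symm]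
  · simp

theorem linSubst_inv_apply (u : GL (Fin n) k) (f : MvPolynomial (Fin n) k) :
    linSubst u (linSubst u⁻¹ f) = f := by
  rw [← AlgHom.comp_apply, ← linSubst_mul, inv_mul_cancel, linSubst_one, AlgHom.id_apply]

theorem linSubst_surjective (u : GL (Fin n) k) : Function.Surjective (linSubst u) :=
  fun f => ⟨_, linSubst_inv_apply u f⟩

theorem mem_transform_iff {u : GL (Fin n) k} {I : Ideal (MvPolynomial (Fin n) k)}
    {f : MvPolynomial (Fin n) k} : f ∈ transform u I ↔ ∃ h ∈ I, linSubst u h = f :=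
  Ideal.mem_map_iff_of_surjective _ (linSubst_surjective u)

theorem linSubst_mem_transform (u : GL (Fin n) k) {I : Ideal (MvPolynomial (Fin n) k)}
    {f : MvPolynomial (Fin n) k} (hf : f ∈ I) : linSubst u f ∈ transform u I :=
  Ideal.mem_map_of_mem _ hf

theorem transform_mul (u v : GL (Fin n) k) (I : Ideal (MvPolynomial (Fin n) k)) :
    transform (u * v) I = transform v (transform u I) := by
  ext f
  simp only [mem_transform_iff, linSubst_mul, AlgHom.comp_apply]
  constructor
  · rintro ⟨h, hI, rfl⟩
    exact ⟨_, ⟨h, hI, rfl⟩, rfl⟩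
  · rintro ⟨_, ⟨h, hI, rfl⟩, rfl⟩
    exact ⟨h, hI, rfl⟩

theorem totalDegree_aeval_le {σ τ R : Type*} [CommRing R] [Nontrivial R]
    (g : σ → MvPolynomial τ R) (hg : ∀ i, (g i).totalDegree ≤ 1) (f : MvPolynomial σ R) :
    (aeval g f).totalDegree ≤ f.totalDegree := by
  rw [aeval_def, eval₂_eq]
  refine totalDegree_finsetSum_le fun m hm => ?_
  refine (totalDegree_mul _ _).trans ?_
  rw [MvPolynomial.algebraMap_eq, totalDegree_C, zero_add]
  refine (totalDegree_finsetProd _ _).trans ?_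
  refine le_trans ?_ (le_totalDegree hm)
  refine Finset.sum_le_sum fun i _ => ?_
  refine (totalDegree_pow _ _).trans ?_
  simpa using Nat.mul_le_mul_left (m i) (hg i)

theorem totalDegree_linSubst_le (u : GL (Fin n) k) (f : MvPolynomial (Fin n) k) :
    (linSubst u f).totalDegree ≤ f.totalDegree := by
  refine totalDegree_aeval_le _ (fun i => ?_) f
  refine totalDegree_finsetSum_le fun j _ => ?_
  refine (totalDegree_mul _ _).trans ?_
  simp

/-- The generic linear substitution, with indeterminate matrix entries. -/
noncomputable def genericSubst (n : ℕ) (k : Type*) [Field k] :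
    MvPolynomial (Fin n) k →ₐ[k] MvPolynomial (Fin n) (MvPolynomial (Fin n × Fin n) k) :=
  MvPolynomial.aeval fun i => ∑ j : Fin n, C (X (i, j)) * X j

theorem map_genericSubst (u : GL (Fin n) k) (f : MvPolynomial (Fin n) k) :
    MvPolynomial.map (MvPolynomial.eval
      fun ij : Fin n × Fin n => (u : Matrix (Fin n) (Fin n) k) ij.1 ij.2)
      (genericSubst n k f) = linSubst u f := by
  induction f using MvPolynomial.induction_on with
  | C a =>
    simp [genericSubst, linSubst, MvPolynomial.algebraMap_apply, MvPolynomial.algebraMap_eq]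
  | add p q hp hq => simp only [map_add, hp, hq]
  | mul_X p i hp =>
    simp only [map_mul, hp, linSubst_X]
    simp [genericSubst]

end LinearSubstitution

/-! ### Zariski open sets and semicontinuity of the counts. -/

section GenericLocus

variable {k : Type*} [Field k] {n : ℕ}

/-- Evaluation of a polynomial in the matrix entries. -/
noncomputable abbrev evalGL (u : GL (Fin n) k) (p : MvPolynomial (Fin n × Fin n) k) : k :=
  MvPolynomial.eval (fun ij : Fin n × Fin n => (u : Matrix (Fin n) (Fin n) k) ij.1 ij.2) p

theorem isZariskiOpen_iff {U : Set (GL (Fin n) k)} :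
    IsZariskiOpen U ↔ ∀ u ∈ U, ∃ p, evalGL u p ≠ 0 ∧ ∀ v, evalGL v p ≠ 0 → v ∈ U := by
  constructor
  · rintro ⟨F, rfl⟩ u ⟨p, hp, hu⟩
    exact ⟨p, hu, fun v hv => ⟨p, hp, hv⟩⟩
  · intro h
    refine ⟨{p | ∀ v, evalGL v p ≠ 0 → v ∈ U}, ?_⟩
    ext u
    constructor
    · intro hu
      obtain ⟨p, hp, hv⟩ := h u hu
      exact ⟨p, hv, hp⟩
    · rintro ⟨p, hp, hu⟩
      exact hp u hu

/-- Multiplying `p` by the generic determinant forces a point of nonvanishing to be invertible. This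
is what makes nonempty open sets meet. -/
theorem exists_evalGL_ne_zero [Infinite k] {p : MvPolynomial (Fin n × Fin n) k} (hp : p ≠ 0) :
    ∃ u : GL (Fin n) k, evalGL u p ≠ 0 := by
  have hdet := Matrix.det_mvPolynomialX_ne_zero (Fin n) k
  obtain ⟨x, hx⟩ : ∃ x, eval x (p * (Matrix.mvPolynomialX (Fin n) (Fin n) k).det) ≠ 0 := by
    by_contra! h
    exact mul_ne_zero hp hdet (MvPolynomial.funext fun x => by simpa using h x)
  rw [map_mul] at hx
  have hA : (Matrix.of fun i j => x (i, j)).det ≠ 0 := by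
    convert right_ne_zero_of_mul hx using 1
    rw [RingHom.map_det]
    congr 1
    ext i j
    simp [Matrix.mvPolynomialX]
  exact ⟨Matrix.GeneralLinearGroup.mkOfDetNeZero _ hA, left_ne_zero_of_mul hx⟩

theorem IsZariskiOpen.inter {U V : Set (GL (Fin n) k)} (hU : IsZariskiOpen U)
    (hV : IsZariskiOpen V) : IsZariskiOpen (U ∩ V) := by
  rw [isZariskiOpen_iff] at *
  rintro u ⟨hu, hu'⟩
  obtain ⟨p, hp, hpU⟩ := hU u hu
  obtain ⟨q, hq, hqV⟩ := hV u hu'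
  refine ⟨p * q, by simpa using ⟨hp, hq⟩, fun v hv => ?_⟩
  rw [evalGL, map_mul] at hv
  exact ⟨hpU v (left_ne_zero_of_mul hv), hqV v (right_ne_zero_of_mul hv)⟩

theorem IsZariskiOpen.inter_nonempty [Infinite k] {U V : Set (GL (Fin n) k)}
    (hU : IsZariskiOpen U) (hV : IsZariskiOpen V) (hU' : U.Nonempty) (hV' : V.Nonempty) :
    (U ∩ V).Nonempty := by
  rw [isZariskiOpen_iff] at *
  obtain ⟨u, hu⟩ := hU'
  obtain ⟨v, hv⟩ := hV'
  obtain ⟨p, hp, hpU⟩ := hU u hu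
  obtain ⟨q, hq, hqV⟩ := hV v hv
  have hp0 : p ≠ 0 := by rintro rfl; simp at hp
  have hq0 : q ≠ 0 := by rintro rfl; simp at hq
  obtain ⟨w, hw⟩ := exists_evalGL_ne_zero (mul_ne_zero hp0 hq0)
  rw [evalGL, map_mul] at hw
  exact ⟨w, hpU w (left_ne_zero_of_mul hw), hqV w (right_ne_zero_of_mul hw)⟩

theorem isZariskiOpen_biInter [Infinite k] {ι : Type*} (s : Finset ι) (U : ι → Set (GL (Fin n) k))
    (hU : ∀ i ∈ s, IsZariskiOpen (U i)) (hU' : ∀ i ∈ s, (U i).Nonempty) :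
    IsZariskiOpen (⋂ i ∈ s, U i) ∧ (⋂ i ∈ s, U i).Nonempty := by
  classical
  induction s using Finset.induction_on with
  | empty =>
    refine ⟨?_, 1, by simp⟩
    rw [isZariskiOpen_iff]
    exact fun u _ => ⟨1, by simp, by simp⟩
  | insert a s _ ih =>
    obtain ⟨h1, h2⟩ := ih (fun i hi => hU i (Finset.mem_insert_of_mem hi))
      (fun i hi => hU' i (Finset.mem_insert_of_mem hi))
    have ha := hU a (Finset.mem_insert_self a s)
    rw [Finset.set_biInter_insert]
    exact ⟨ha.inter h1, ha.inter_nonempty h1 (hU' a (Finset.mem_insert_self a s)) h2⟩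

/-- The number of leading monomials of `uI` in `T` is lower semicontinuous in `u`. -/
theorem exists_polynomial_le_card_leadIn (I : Ideal (MvPolynomial (Fin n) k)) {d : ℕ}
    {T : Finset (Fin n →₀ ℕ)} (hT : IsUpperInDegree d T) (u : GL (Fin n) k) :
    ∃ p, evalGL u p ≠ 0 ∧ ∀ v, evalGL v p ≠ 0 →
      (leadIn (transform u I) T).card ≤ (leadIn (transform v I) T).card := by
  classical
  set W := leadIn (transform u I) T
  have hex : ∀ w : W, ∃ h ∈ I, h.totalDegree ≤ d ∧ (revLex n).degree (linSubst u h) = w ∧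
      coeff w.1 (linSubst u h) = 1 := by
    rintro ⟨w, hw⟩
    obtain ⟨hwT, hwl⟩ := mem_leadIn.1 hw
    obtain ⟨f, hf, hd, h1⟩ := exists_monic_of_mem_leadSet hwl
    have hfd : f.totalDegree ≤ d := by
      rw [← (hT w hwT).1, ← hd]
      exact totalDegree_le_degree_degree f
    obtain ⟨h, hI, rfl⟩ := mem_transform_iff.1 hf
    refine ⟨h, hI, ?_, hd, h1⟩
    have h2 : linSubst u⁻¹ (linSubst u h) = h := by
      have := linSubst_inv_apply u⁻¹ h
      rwa [inv_inv] at this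
    rw [← h2]
    exact (totalDegree_linSubst_le _ _).trans hfd
  choose h hI hd hdeg h1 using hex
  -- The preimages `h` are fixed, so this minor is polynomial in the matrix entries. At `u` it is
  -- triangular with unit diagonal, because row `w` has leading monomial `w`.
  let A : Matrix W W (MvPolynomial (Fin n × Fin n) k) :=
    Matrix.of fun i j => coeff j.1 (genericSubst n k (h i))
  have hA : ∀ v, evalGL v A.det = (Matrix.of fun i j : W => coeff j.1 (linSubst v (h i))).det := by
    intro v
    rw [evalGL, RingHom.map_det]
    congr 1
    ext i j
    simp only [A, RingHom.mapMatrix_apply, Matrix.map_apply, Matrix.of_apply]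
    rw [← coeff_map, map_genericSubst]
  refine ⟨A.det, ?_, fun v hv => ?_⟩
  · rw [hA]
    refine det_ne_zero_of_triangular (fun w : W => OrderDual.toDual ((revLex n).toSyn w.1))
      (fun a b hab => Subtype.ext ((revLex n).toSyn.injective hab)) _ ?_ ?_
    · intro i j hij
      rw [OrderDual.toDual_le_toDual, ← hdeg i]
      exact (revLex n).le_degree (mem_support_iff.2 hij)
    · intro i
      simp [h1]
  · rw [hA] at hv
    have := card_le_card_leadIn hT (J := transform v I) _
      (fun i => linSubst_mem_transform v (hI i))
      (fun i => (totalDegree_linSubst_le v (h i)).trans (hd i)) (fun j : W => j.1)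
      (fun j => (mem_leadIn.1 j.2).1) hv
    simpa using this

/-- The largest number of leading monomials in `T` that an ideal `uI` can have. -/
noncomputable def maxLead (I : Ideal (MvPolynomial (Fin n) k)) (T : Finset (Fin n →₀ ℕ)) : ℕ :=
  ⨆ u : GL (Fin n) k, (leadIn (transform u I) T).card

theorem bddAbove_card_leadIn (I : Ideal (MvPolynomial (Fin n) k)) (T : Finset (Fin n →₀ ℕ)) :
    BddAbove (Set.range fun u : GL (Fin n) k => (leadIn (transform u I) T).card) := by
  classical
  refine ⟨T.card, ?_⟩
  rintro _ ⟨u, rfl⟩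
  exact Finset.card_le_card (Finset.filter_subset _ _)

theorem card_leadIn_le_maxLead (I : Ideal (MvPolynomial (Fin n) k)) (T : Finset (Fin n →₀ ℕ))
    (u : GL (Fin n) k) : (leadIn (transform u I) T).card ≤ maxLead I T :=
  le_ciSup (bddAbove_card_leadIn I T) u

/-- The `u` for which `uI` has as many leading monomials in `T` as possible. -/
def maxLocus (I : Ideal (MvPolynomial (Fin n) k)) (T : Finset (Fin n →₀ ℕ)) :
    Set (GL (Fin n) k) :=
  {u | (leadIn (transform u I) T).card = maxLead I T}

theorem maxLocus_nonempty (I : Ideal (MvPolynomial (Fin n) k)) (T : Finset (Fin n →₀ ℕ)) :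
    (maxLocus I T).Nonempty :=
  Nat.sSup_mem (Set.range_nonempty _) (bddAbove_card_leadIn I T)

theorem isZariskiOpen_maxLocus (I : Ideal (MvPolynomial (Fin n) k)) {d : ℕ}
    {T : Finset (Fin n →₀ ℕ)} (hT : IsUpperInDegree d T) : IsZariskiOpen (maxLocus I T) := by
  rw [isZariskiOpen_iff]
  intro u hu
  obtain ⟨p, hp, hpv⟩ := exists_polynomial_le_card_leadIn I hT u
  refine ⟨p, hp, fun v hv => le_antisymm (card_leadIn_le_maxLead I T v) ?_⟩
  exact (show _ = _ from hu) ▸ hpv v hv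

end GenericLocus

end StdPairs

namespace StdPairs

open MvPolynomial

/-! ### Existence and uniqueness of the generic initial ideal. -/

section GenericInitialIdeal

variable {k : Type*} [Field k] {n : ℕ}

/-- The monomials of degree `d`. -/
noncomputable def ofDegree (n d : ℕ) : Finset (Fin n →₀ ℕ) :=
  (Finsupp.finite_of_degree_eq d).toFinset

/-- The monomials of the same degree as `m` that are at least `m`. -/
noncomputable def upperGE (m : Fin n →₀ ℕ) : Finset (Fin n →₀ ℕ) :=
  (ofDegree n m.degree).filter fun w => (revLex n).toSyn m ≤ (revLex n).toSyn w

/-- The monomials of the same degree as `m` that are bigger than `m`. -/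
noncomputable def upperGT (m : Fin n →₀ ℕ) : Finset (Fin n →₀ ℕ) :=
  (ofDegree n m.degree).filter fun w => (revLex n).toSyn m < (revLex n).toSyn w

theorem mem_ofDegree {d : ℕ} {w : Fin n →₀ ℕ} : w ∈ ofDegree n d ↔ w.degree = d := by
  simp [ofDegree]

theorem mem_upperGE {m w : Fin n →₀ ℕ} :
    w ∈ upperGE m ↔ w.degree = m.degree ∧ (revLex n).toSyn m ≤ (revLex n).toSyn w := by
  simp [upperGE, mem_ofDegree]

theorem mem_upperGT {m w : Fin n →₀ ℕ} :
    w ∈ upperGT m ↔ w.degree = m.degree ∧ (revLex n).toSyn m < (revLex n).toSyn w := by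
  simp [upperGT, mem_ofDegree]

theorem isUpperInDegree_upperGE (m : Fin n →₀ ℕ) : IsUpperInDegree m.degree (upperGE m) := by
  intro w hw
  rw [mem_upperGE] at hw
  exact ⟨hw.1, fun w' h h' => mem_upperGE.2 ⟨h, hw.2.trans h'⟩⟩

theorem isUpperInDegree_upperGT (m : Fin n →₀ ℕ) : IsUpperInDegree m.degree (upperGT m) := by
  intro w hw
  rw [mem_upperGT] at hw
  exact ⟨hw.1, fun w' h h' => mem_upperGT.2 ⟨h, hw.2.trans_le h'⟩⟩

theorem isUpperInDegree_ofDegree (d : ℕ) : IsUpperInDegree d (ofDegree n d) :=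
  fun _ hw => ⟨mem_ofDegree.1 hw, fun _ h _ => mem_ofDegree.2 h⟩

/-- The monomials that are leading monomials of `uI` for generic `u`. -/
def genericLeadSet (I : Ideal (MvPolynomial (Fin n) k)) : Set (Fin n →₀ ℕ) :=
  {m | maxLead I (upperGT m) < maxLead I (upperGE m)}

/-- The two upper sets differ only by `m`, so membership is read off from counts that are
generically maximal. -/
theorem mem_leadSet_iff_card_lt {J : Ideal (MvPolynomial (Fin n) k)} {m : Fin n →₀ ℕ} :
    m ∈ leadSet J ↔ (leadIn J (upperGT m)).card < (leadIn J (upperGE m)).card := by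
  constructor
  · intro hm
    refine Finset.card_lt_card (Finset.ssubset_iff_of_subset ?_ |>.2 ⟨m, ?_, ?_⟩)
    · intro w hw
      rw [mem_leadIn, mem_upperGT] at hw
      exact mem_leadIn.2 ⟨mem_upperGE.2 ⟨hw.1.1, hw.1.2.le⟩, hw.2⟩
    · exact mem_leadIn.2 ⟨mem_upperGE.2 ⟨rfl, le_rfl⟩, hm⟩
    · simp [mem_leadIn, mem_upperGT]
  · intro h
    by_contra hm
    refine absurd (Finset.card_le_card fun w hw => ?_) (not_le.2 h)
    rw [mem_leadIn, mem_upperGE] at hw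
    refine mem_leadIn.2 ⟨mem_upperGT.2 ⟨hw.1.1, lt_of_le_of_ne hw.1.2 fun he => hm ?_⟩, hw.2⟩
    rw [(revLex n).toSyn.injective he]
    exact hw.2

/-- The `u` that are generic with respect to the monomials in `F`. -/
def genericOn (I : Ideal (MvPolynomial (Fin n) k)) (F : Finset (Fin n →₀ ℕ)) :
    Set (GL (Fin n) k) :=
  ⋂ m ∈ F, maxLocus I (upperGT m) ∩ maxLocus I (upperGE m)

theorem mem_leadSet_transform_iff {I : Ideal (MvPolynomial (Fin n) k)}
    {F : Finset (Fin n →₀ ℕ)} {u : GL (Fin n) k} (hu : u ∈ genericOn I F) {m : Fin n →₀ ℕ}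
    (hm : m ∈ F) : m ∈ leadSet (transform u I) ↔ m ∈ genericLeadSet I := by
  obtain ⟨h1, h2⟩ := Set.mem_iInter₂.1 hu m hm
  rw [mem_leadSet_iff_card_lt, show _ = _ from h1, show _ = _ from h2]
  rfl

variable [Infinite k]

theorem isZariskiOpen_genericOn (I : Ideal (MvPolynomial (Fin n) k))
    (F : Finset (Fin n →₀ ℕ)) : IsZariskiOpen (genericOn I F) ∧ (genericOn I F).Nonempty := by
  have h1 := fun m => isZariskiOpen_maxLocus I (isUpperInDegree_upperGT m)
  have h2 := fun m => isZariskiOpen_maxLocus I (isUpperInDegree_upperGE m)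
  exact isZariskiOpen_biInter F _ (fun m _ => (h1 m).inter (h2 m))
    fun m _ => (h1 m).inter_nonempty (h2 m) (maxLocus_nonempty _ _) (maxLocus_nonempty _ _)

/-- There is a nonempty Zariski open set on which the leading monomials of `uI` are the
generic ones. -/
theorem exists_isZariskiOpen_leadSet_eq (I : Ideal (MvPolynomial (Fin n) k)) :
    ∃ U : Set (GL (Fin n) k), IsZariskiOpen U ∧ U.Nonempty ∧
      ∀ u ∈ U, leadSet (transform u I) = genericLeadSet I := by
  classical
  have hpwo : (genericLeadSet I).IsPWO := Set.isPWO_of_wellQuasiOrderedLE _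
  -- Dickson's lemma: finitely many minimal elements, hence finitely many open conditions, suffice
  -- for one inclusion.
  have hfin : {m | Minimal (· ∈ genericLeadSet I) m}.Finite :=
    (setOfPred_minimal_antichain _).finite_of_partiallyWellOrderedOn
      (hpwo.mono fun _ h => h.1)
  obtain ⟨hU, hU'⟩ := isZariskiOpen_genericOn I hfin.toFinset
  refine ⟨_, hU, hU', fun u hu => ?_⟩
  have hsub : genericLeadSet I ⊆ leadSet (transform u I) := by
    intro m hm
    obtain ⟨z, hz, hz'⟩ := hpwo.exists_le_minimal hm
    refine mem_leadSet_of_le ?_ hz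
    exact (mem_leadSet_transform_iff hu (by simpa using hz')).2 hz'.1
  refine (Set.Subset.antisymm hsub fun m hm => ?_).symm
  -- The other inclusion is by counting in one degree. For `v` generic on that degree, the leading
  -- monomials of `vI` are among those of `uI` and already attain the maximal number, so the two
  -- sets agree.
  have hT := isUpperInDegree_ofDegree (n := n) m.degree
  obtain ⟨v, hv, hv'⟩ := (isZariskiOpen_genericOn I (ofDegree n m.degree)).1.inter_nonempty
    (isZariskiOpen_maxLocus I hT) (isZariskiOpen_genericOn I _).2 (maxLocus_nonempty I _)
  have hle := (card_leadIn_le_maxLead I (ofDegree n m.degree) u).trans_eq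
    (show _ = _ from hv').symm
  have hss : leadIn (transform v I) (ofDegree n m.degree) ⊆
      leadIn (transform u I) (ofDegree n m.degree) := by
    intro w hw
    rw [mem_leadIn] at hw ⊢
    exact ⟨hw.1, hsub ((mem_leadSet_transform_iff hv hw.1).1 hw.2)⟩
  have hmv : m ∈ leadIn (transform v I) (ofDegree n m.degree) := by
    rw [Finset.eq_of_subset_of_card_le hss hle]
    exact mem_leadIn.2 ⟨mem_ofDegree.2 rfl, hm⟩
  exact (mem_leadSet_transform_iff hv (mem_ofDegree.2 rfl)).1 (mem_leadIn.1 hmv).2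

theorem exists_isGin (I : Ideal (MvPolynomial (Fin n) k)) : ∃ G, IsGin I G := by
  obtain ⟨U, hU, ⟨u, hu⟩, h⟩ := exists_isZariskiOpen_leadSet_eq I
  refine ⟨initialIdeal (transform u I), U, ⟨hU, ⟨u, hu⟩, fun v hv w hw => ?_⟩, fun v hv => ?_⟩
  · rw [initialIdeal_eq_iff, h v hv, h w hw]
  · rw [initialIdeal_eq_iff, h v hv, h u hu]

theorem IsGin.initialIdeal_eq {I G : Ideal (MvPolynomial (Fin n) k)} (hG : IsGin I G)
    {U : Set (GL (Fin n) k)} (hU : IsGenericLocus I U) {u : GL (Fin n) k} (hu : u ∈ U) :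
    initialIdeal (transform u I) = G := by
  obtain ⟨V, hV, h⟩ := hG
  obtain ⟨v, hv, hv'⟩ := hU.1.inter_nonempty hV.1 hU.2.1 hV.2.1
  rw [← h v hv', hU.2.2 u hu v hv]

theorem IsGin.unique {I G G' : Ideal (MvPolynomial (Fin n) k)} (hG : IsGin I G)
    (hG' : IsGin I G') : G = G' := by
  obtain ⟨V, hV, h⟩ := hG
  obtain ⟨v, hv⟩ := hV.2.1
  rw [← h v hv, hG'.initialIdeal_eq hV hv]

/-- An arbitrary generic locus meets the open set of maximal count, and counts are constant on the
locus. -/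
theorem IsGenericLocus.card_leadIn_eq {I : Ideal (MvPolynomial (Fin n) k)}
    {U : Set (GL (Fin n) k)} (hU : IsGenericLocus I U) {u : GL (Fin n) k} (hu : u ∈ U)
    {d : ℕ} {T : Finset (Fin n →₀ ℕ)} (hT : IsUpperInDegree d T) :
    (leadIn (transform u I) T).card = maxLead I T := by
  obtain ⟨v, hv, hv'⟩ := hU.1.inter_nonempty (isZariskiOpen_maxLocus I hT) hU.2.1
    (maxLocus_nonempty I T)
  rw [← show _ = _ from hv', leadIn, leadIn, initialIdeal_eq_iff.1 (hU.2.2 u hu v hv)]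

end GenericInitialIdeal

end StdPairs

namespace StdPairs

open MvPolynomial

/-! ### Strong stability by scaling and shearing. -/

section BorelMoves

variable {k : Type*} [Field k] {n : ℕ}

theorem coeff_prod_of_degree_le {σ ι R : Type*} [CommRing R] (mo : MonomialOrder σ)
    (P : ι → MvPolynomial σ R) (d : ι → σ →₀ ℕ) (s : Finset ι)
    (h : ∀ i ∈ s, mo.toSyn (mo.degree (P i)) ≤ mo.toSyn (d i)) :
    coeff (∑ i ∈ s, d i) (∏ i ∈ s, P i) = ∏ i ∈ s, coeff (d i) (P i) := by
  classical
  induction s using Finset.induction_on with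
  | empty => simp
  | insert a s has ih =>
    simp only [Finset.prod_insert has, Finset.sum_insert has]
    rw [mo.coeff_mul_of_add_of_degree_le (h a (Finset.mem_insert_self a s)),
      ih fun i hi => h i (Finset.mem_insert_of_mem hi)]
    refine mo.degree_prod_le.trans ?_
    rw [map_sum, map_sum]
    exact Finset.sum_le_sum fun i hi => h i (Finset.mem_insert_of_mem hi)

/-- The bound depends only on the row, so each term of the Leibniz expansion has degree at most `∑
i, d i`, with coefficient there the product of the entries' coefficients at the bounds. -/
theorem coeff_det_of_degree_le {σ ι R : Type*} [CommRing R] [Fintype ι] [DecidableEq ι]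
    (mo : MonomialOrder σ) (M : Matrix ι ι (MvPolynomial σ R)) (d : ι → σ →₀ ℕ)
    (h : ∀ i j, mo.toSyn (mo.degree (M i j)) ≤ mo.toSyn (d i)) :
    coeff (∑ i, d i) M.det = (Matrix.of fun i j => coeff (d i) (M i j)).det := by
  rw [Matrix.det_apply, Matrix.det_apply, coeff_sum]
  refine Finset.sum_congr rfl fun τ _ => ?_
  rw [Units.smul_def, Units.smul_def, coeff_smul, ← Equiv.sum_comp τ,
    coeff_prod_of_degree_le mo _ _ _ fun i _ => h (τ i) i]
  rfl

/-- The substitution `X j ↦ X j + X l` fixing the other variables. -/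
noncomputable def shear (k : Type*) [Field k] (j l : Fin n) (h : j ≠ l) : GL (Fin n) k :=
  Matrix.GeneralLinearGroup.mkOfDetNeZero (Matrix.transvection j l 1)
    (by rw [Matrix.det_transvection_of_ne _ _ h]; exact one_ne_zero)

/-- The substitution `X i ↦ t i * X i`. -/
noncomputable def scaling (t : Fin n → k) (h : ∀ i, t i ≠ 0) : GL (Fin n) k :=
  Matrix.GeneralLinearGroup.mkOfDetNeZero (Matrix.diagonal t)
    (by rw [Matrix.det_diagonal]; exact Finset.prod_ne_zero_iff.2 fun i _ => h i)

theorem linSubst_shear_X_self (j l : Fin n) (h : j ≠ l) :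
    linSubst (shear k j l h) (X j) = X j + X l := by
  rw [linSubst_X]
  have : ∀ i, ((shear k j l h : GL (Fin n) k) : Matrix (Fin n) (Fin n) k) j i =
      (if j = i then 1 else 0) + if l = i then 1 else 0 := by
    intro i
    simp [shear, Matrix.GeneralLinearGroup.mkOfDetNeZero, Matrix.transvection, Matrix.one_apply,
      Matrix.single_apply]
  simp [this, add_mul, Finset.sum_add_distrib, apply_ite C]

theorem linSubst_shear_X_of_ne (j l : Fin n) (h : j ≠ l) {i : Fin n} (hi : i ≠ j) :
    linSubst (shear k j l h) (X i) = X i := by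
  rw [linSubst_X]
  have : ∀ i', ((shear k j l h : GL (Fin n) k) : Matrix (Fin n) (Fin n) k) i i' =
      (if i = i' then 1 else 0) := by
    intro i'
    simp [shear, Matrix.GeneralLinearGroup.mkOfDetNeZero, Matrix.transvection, Matrix.one_apply,
      hi.symm]
  simp [this, apply_ite C]

theorem linSubst_scaling_monomial (t : Fin n → k) (h : ∀ i, t i ≠ 0) (m : Fin n →₀ ℕ) (c : k) :
    linSubst (scaling t h) (monomial m c) = monomial m (c * m.prod fun i e => t i ^ e) := by
  have hX : ∀ i, linSubst (scaling t h) (X i) = C (t i) * X i := by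
    intro i
    rw [linSubst_X, Finset.sum_eq_single i]
    · simp [scaling, Matrix.GeneralLinearGroup.mkOfDetNeZero]
    · intro i' _ hi'
      simp [scaling, Matrix.GeneralLinearGroup.mkOfDetNeZero, Matrix.diagonal_apply_ne _ hi'.symm]
    · simp
  rw [monomial_eq, monomial_eq, map_mul, algHom_C, Finsupp.prod, Finsupp.prod, map_prod]
  simp only [map_pow, hX, mul_pow, Finset.prod_mul_distrib, map_mul, map_prod]
  simp only [mul_assoc, MvPolynomial.algebraMap_eq]

theorem linSubst_shear_monomial (j l : Fin n) (h : j ≠ l) (w : Fin n →₀ ℕ) :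
    linSubst (shear k j l h) (monomial w 1) = ∑ s ∈ Finset.range (w j + 1),
      monomial (w.erase j + Finsupp.single j (w j - s) + Finsupp.single l s)
        ((w j).choose s : k) := by
  have h1 : linSubst (shear k j l h) (monomial (w.erase j) 1) = monomial (w.erase j) 1 := by
    rw [monomial_eq, map_mul, algHom_C, Finsupp.prod, map_prod]
    simp only [map_pow]
    congr 1
    refine Finset.prod_congr rfl fun i hi => ?_
    rw [linSubst_shear_X_of_ne]
    rintro rfl
    simp at hi
  have h2 : (monomial w (1 : k)) = X j ^ w j * monomial (w.erase j) 1 := by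
    rw [X_pow_eq_monomial, monomial_mul, Finsupp.single_add_erase, one_mul]
  rw [h2, map_mul, map_pow, h1, linSubst_shear_X_self, add_comm (X j), add_pow, Finset.sum_mul]
  refine Finset.sum_congr rfl fun s _ => ?_
  rw [X_pow_eq_monomial, X_pow_eq_monomial, monomial_mul, ← map_natCast C, mul_comm _ (C _),
    C_mul_monomial, monomial_mul]
  exact congrArg₂ (fun a b => monomial a b) (by abel) (by simp)

theorem toSyn_single_lt {j l : Fin n} (h : j < l) :
    (revLex n).toSyn (Finsupp.single j 1) < (revLex n).toSyn (Finsupp.single l 1) := by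
  rw [revLex_lt_iff]
  refine Or.inr ⟨by simp, j, fun i hi => ?_, ?_⟩
  · rw [Finsupp.single_eq_of_ne hi.ne, Finsupp.single_eq_of_ne (hi.trans h).ne]
  · rw [Finsupp.single_eq_of_ne h.ne]
    simp

/-- Each term of the image trades some copies of `X j` for the larger variable `X l`. -/
theorem toSyn_le_of_coeff_shear_ne_zero {j l : Fin n} (h : j < l) {w p : Fin n →₀ ℕ}
    (hp : coeff p (linSubst (shear k j l h.ne) (monomial w 1)) ≠ 0) :
    (revLex n).toSyn w ≤ (revLex n).toSyn p := by
  classical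
  rw [linSubst_shear_monomial, coeff_sum] at hp
  obtain ⟨s, hs, hne⟩ := Finset.exists_ne_zero_of_sum_ne_zero hp
  rw [coeff_monomial] at hne
  have hp' := (ite_ne_right_iff.1 hne).1
  have hs' : s ≤ w j := Nat.lt_succ_iff.1 (Finset.mem_range.1 hs)
  have hw : w = w.erase j + Finsupp.single j (w j - s) + Finsupp.single j s := by
    rw [add_assoc, ← Finsupp.single_add, Nat.sub_add_cancel hs', Finsupp.erase_add_single]
  have hsingle : ∀ i : Fin n, Finsupp.single i s = s • Finsupp.single i 1 := by
    intro i
    simp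
  conv_lhs => rw [hw]
  rw [← hp', map_add, map_add _ _ (Finsupp.single l s), hsingle j, hsingle l, map_nsmul, map_nsmul]
  exact add_le_add_right (nsmul_le_nsmul_right (toSyn_single_lt h).le s) _

theorem coeff_shear_monomial {j l : Fin n} (h : j ≠ l) (w : Fin n →₀ ℕ) {s : ℕ} (hs : s ≤ w j) :
    coeff (w.erase j + Finsupp.single j (w j - s) + Finsupp.single l s)
      (linSubst (shear k j l h) (monomial w 1)) = (w j).choose s := by
  classical
  rw [linSubst_shear_monomial, coeff_sum, Finset.sum_eq_single s]
  · simp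
  · intro s' _ hne
    rw [coeff_monomial, if_neg]
    intro he
    have := DFunLike.congr_fun he l
    simp [Finsupp.single_eq_of_ne h.symm] at this
    exact hne this
  · intro h'
    exact absurd (Finset.mem_range.2 (Nat.lt_succ_iff.2 hs)) h'

theorem coeff_shear_monomial_self {j l : Fin n} (h : j ≠ l) (w : Fin n →₀ ℕ) :
    coeff w (linSubst (shear k j l h) (monomial w 1)) = 1 := by
  have := coeff_shear_monomial (k := k) h w (Nat.zero_le _)
  simpa [Finsupp.erase_add_single] using this

theorem coeff_shear_monomial_succ {j l : Fin n} (h : j ≠ l) (m : Fin n →₀ ℕ) :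
    coeff (m + Finsupp.single l 1)
      (linSubst (shear k j l h) (monomial (m + Finsupp.single j 1) 1)) = (m j + 1 : ℕ) := by
  have := coeff_shear_monomial (k := k) h (m + Finsupp.single j 1) (s := 1) (by simp)
  simpa [Finsupp.erase_add, Finsupp.erase_add_single] using this

/-- The coefficient at `p` of the image of `f` under the scaling by indeterminates followed by
a shear. -/
noncomputable def shearCoeff (g : GL (Fin n) k) (f : MvPolynomial (Fin n) k) (p : Fin n →₀ ℕ) :
    MvPolynomial (Fin n) k :=
  ∑ m ∈ f.support, monomial m (coeff m f * coeff p (linSubst g (monomial m 1)))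

theorem coeff_shearCoeff (g : GL (Fin n) k) (f : MvPolynomial (Fin n) k) (p m : Fin n →₀ ℕ) :
    coeff m (shearCoeff g f p) = coeff m f * coeff p (linSubst g (monomial m 1)) := by
  classical
  simp only [shearCoeff, coeff_sum, coeff_monomial, Finset.sum_ite_eq', mem_support_iff]
  split_ifs with h
  · rfl
  · rw [not_not.1 h, zero_mul]

/-- Scaling comes first, so the indeterminates record which monomial of `f` a contribution comes
from. -/
theorem eval_shearCoeff (g : GL (Fin n) k) (f : MvPolynomial (Fin n) k) (p : Fin n →₀ ℕ)
    (t : Fin n → k) (ht : ∀ i, t i ≠ 0) :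
    eval t (shearCoeff g f p) = coeff p (linSubst (scaling t ht * g) f) := by
  rw [linSubst_mul, AlgHom.comp_apply]
  conv_rhs => rw [f.as_sum]
  simp only [map_sum, coeff_sum, shearCoeff, linSubst_scaling_monomial, eval_monomial]
  refine Finset.sum_congr rfl fun m _ => ?_
  have : ∀ c : k, monomial m c = c • monomial m (1 : k) := by
    intro c
    simp [smul_monomial]
  rw [this (_ * _), map_smul, coeff_smul, smul_eq_mul]
  ring

theorem degree_shearCoeff_le (g : GL (Fin n) k) (f : MvPolynomial (Fin n) k) (p : Fin n →₀ ℕ) :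
    (revLex n).toSyn ((revLex n).degree (shearCoeff g f p)) ≤
      (revLex n).toSyn ((revLex n).degree f) := by
  refine (revLex n).degree_le_degree_of_support_subset fun m hm => ?_
  rw [mem_support_iff, coeff_shearCoeff] at hm
  exact mem_support_iff.2 (left_ne_zero_of_mul hm)

theorem exists_eval_ne_zero_of_ne_zero [Infinite k] {p : MvPolynomial (Fin n) k} (hp : p ≠ 0) :
    ∃ t : Fin n → k, (∀ i, t i ≠ 0) ∧ eval t p ≠ 0 := by
  have hX : (∏ i, X i : MvPolynomial (Fin n) k) ≠ 0 :=
    Finset.prod_ne_zero_iff.2 fun i _ => X_ne_zero i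
  obtain ⟨t, ht⟩ : ∃ t, eval t (p * ∏ i, X i) ≠ 0 := by
    by_contra! h
    exact mul_ne_zero hp hX (MvPolynomial.funext fun x => by rw [h x, map_zero])
  rw [map_mul, map_prod] at ht
  refine ⟨t, fun i => ?_, left_ne_zero_of_mul ht⟩
  simpa using Finset.prod_ne_zero_iff.1 (right_ne_zero_of_mul ht) i (Finset.mem_univ i)

/-- Generic initial ideals in characteristic zero are strongly stable. -/
theorem IsGenericLocus.add_single_mem_leadSet [CharZero k] {I : Ideal (MvPolynomial (Fin n) k)}
    {U : Set (GL (Fin n) k)} (hU : IsGenericLocus I U) {u : GL (Fin n) k} (hu : u ∈ U)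
    {m : Fin n →₀ ℕ} {j l : Fin n} (hjl : j < l)
    (hm : m + Finsupp.single j 1 ∈ leadSet (transform u I)) :
    m + Finsupp.single l 1 ∈ leadSet (transform u I) := by
  classical
  by_contra hq
  set q := m + Finsupp.single l 1 with hqdef
  have hT := isUpperInDegree_upperGE q
  set L := leadIn (transform u I) (upperGE q) with hL
  -- The index `none` is the extra polynomial: its leading monomial has the factor `X j` and is to
  -- produce the missing monomial `q`.
  let e : Option L → Fin n →₀ ℕ := fun x => x.elim q fun y => y.1
  let w : Option L → Fin n →₀ ℕ := fun x => x.elim (m + Finsupp.single j 1) fun y => y.1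
  have heT : ∀ x, e x ∈ upperGE q := by
    rintro (_ | y)
    · exact mem_upperGE.2 ⟨rfl, le_rfl⟩
    · exact (mem_leadIn.1 y.2).1
  have hwdeg : ∀ x, (w x).degree = q.degree := by
    rintro (_ | y)
    · simp [w, hqdef]
    · exact (mem_upperGE.1 (mem_leadIn.1 y.2).1).1
  have hw : ∀ x, w x ∈ leadSet (transform u I) := by
    rintro (_ | y)
    · exact hm
    · exact (mem_leadIn.1 y.2).2
  choose f hf hfd hf1 using fun x => exists_monic_of_mem_leadSet (hw x)
  let g := shear k j l hjl.ne
  let M : Matrix (Option L) (Option L) (MvPolynomial (Fin n) k) :=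
    Matrix.of fun x y => shearCoeff g (f x) (e y)
  have hM : M.det ≠ 0 := by
    -- This coefficient retains only the leading term of each `f x`.
    have hc := coeff_det_of_degree_le (revLex n) M w fun x y => by
      rw [← hfd x]
      exact degree_shearCoeff_le _ _ _
    intro h0
    rw [h0, coeff_zero] at hc
    refine det_ne_zero_of_triangular (fun x => (revLex n).toSyn (e x)) ?_ _ ?_ ?_ hc.symm
    · intro x y hxy
      have hxy := (revLex n).toSyn.injective hxy
      rcases x with _ | x <;> rcases y with _ | y
      · rfl
      · exact absurd (mem_leadIn.1 y.2).2 (by rwa [← show q = y.1 from hxy])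
      · exact absurd (mem_leadIn.1 x.2).2 (by rwa [show x.1 = q from hxy])
      · exact congrArg some (Subtype.ext hxy)
    -- Row `none` is labelled by `q`, the least element of the upper set; the other rows start at
    -- their own label since the shear only moves monomials up.
    · intro x y hxy
      rcases x with _ | x
      · exact (mem_upperGE.1 (heT y)).2
      · simp only [M, Matrix.of_apply, coeff_shearCoeff] at hxy
        exact toSyn_le_of_coeff_shear_ne_zero hjl (right_ne_zero_of_mul hxy)
    · intro x
      simp only [M, Matrix.of_apply, coeff_shearCoeff, hf1, one_mul]
      rcases x with _ | x
      · change coeff (m + Finsupp.single l 1)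
          (linSubst g (monomial (m + Finsupp.single j 1) 1)) ≠ 0
        -- The diagonal entry is `m j + 1`, nonzero in characteristic zero.
        rw [coeff_shear_monomial_succ]
        exact Nat.cast_ne_zero.2 (Nat.succ_ne_zero _)
      · change coeff x.1 (linSubst g (monomial x.1 1)) ≠ 0
        rw [coeff_shear_monomial_self]
        exact one_ne_zero
  obtain ⟨t, ht, hdet⟩ := exists_eval_ne_zero_of_ne_zero hM
  have hcard := card_le_card_leadIn hT (J := transform (u * (scaling t ht * g)) I)
    (fun x => linSubst (scaling t ht * g) (f x))
    (fun x => by rw [transform_mul]; exact linSubst_mem_transform _ (hf x))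
    (fun x => (totalDegree_linSubst_le _ _).trans <|
      (totalDegree_le_degree_degree _).trans_eq (by rw [hfd, hwdeg])) e heT (by
        convert hdet using 1
        rw [RingHom.map_det]
        congr 1
        ext x y
        exact (eval_shearCoeff g (f x) (e y) t ht).symm)
  -- The generic count `L.card` is maximal, yet the new coordinates give at least `L.card + 1`.
  have hmax := card_leadIn_le_maxLead I (upperGE q) (u * (scaling t ht * g))
  rw [← hU.card_leadIn_eq hu hT, ← hL] at hmax
  simp only [Fintype.card_option, Fintype.card_coe] at hcard
  omega

end BorelMoves

end StdPairs

namespace StdPairs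

/-! ### Inclusions between cones. -/

section Cones

variable {n : ℕ}

theorem self_mem_cone (a : Fin n →₀ ℕ) (σ : Set (Fin n)) : a ∈ cone a σ :=
  ⟨0, by simp, by simp⟩

theorem subset_of_cone_subset_cone {a b : Fin n →₀ ℕ} {σ τ : Set (Fin n)}
    (h : cone a τ ⊆ cone b σ) : τ ⊆ σ := by
  intro j hj
  by_contra hjσ
  -- An exponent above `b j` cannot occur in `cone b σ` when `j ∉ σ`.
  have hmem : a + Finsupp.single j (b j + 1) ∈ cone a τ := by
    refine ⟨_, fun i hi => ?_, rfl⟩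
    rw [Finset.mem_singleton.1 (Finsupp.support_single_subset hi)]
    exact hj
  obtain ⟨c, hc, he⟩ := h hmem
  have hcj : c j = 0 := Finsupp.notMem_support_iff.1 fun h => hjσ (hc h)
  have := DFunLike.congr_fun he j
  simp [hcj] at this
  omega

theorem initSeg_zero : initSeg n 0 = ∅ := by
  ext j
  simp [initSeg]

theorem singleIdx_subset_initSeg {i : ℕ} : singleIdx n i ⊆ initSeg n i :=
  fun _ h => le_of_eq h

end Cones

/-! ### Standard pairs of a strongly stable ideal. -/

section StronglyStable

variable {n : ℕ}

/-- The complement of a strongly stable set of monomials. -/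
structure IsStableComplement (B : Set (Fin n →₀ ℕ)) : Prop where
  mem_of_le : ∀ {m m' : Fin n →₀ ℕ}, m ∈ B → m' ≤ m → m' ∈ B
  move : ∀ {m : Fin n →₀ ℕ} {j l : Fin n}, j < l → m + Finsupp.single l 1 ∈ B →
    m + Finsupp.single j 1 ∈ B

/-- The copies of `X l` are exchanged one at a time for the variables of `c`, all of index at most
`l`. -/
theorem IsStableComplement.add_mem {B : Set (Fin n →₀ ℕ)} (hB : IsStableComplement B)
    {l : Fin n} (c : Fin n →₀ ℕ) (hc : ∀ j ∈ c.support, j ≤ l) (a : Fin n →₀ ℕ)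
    (h : a + Finsupp.single l c.degree ∈ B) : a + c ∈ B := by
  induction hd : c.degree generalizing c a with
  | zero =>
    rw [(Finsupp.degree_eq_zero_iff c).1 hd]
    simpa [hd] using h
  | succ s ih =>
    have hc0 : c ≠ 0 := by
      rintro rfl
      simp at hd
    obtain ⟨j, hj⟩ := Finsupp.support_nonempty_iff.2 hc0
    obtain ⟨c', rfl⟩ : ∃ c', c = Finsupp.single j 1 + c' := by
      refine exists_add_of_le ?_
      rw [Finsupp.single_le_iff]
      exact Nat.one_le_iff_ne_zero.2 (Finsupp.mem_support_iff.1 hj)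
    have hd' : c'.degree = s := by
      rw [map_add, Finsupp.degree_single] at hd
      omega
    rw [← add_assoc]
    refine ih c' (fun i hi => hc i ?_) _ ?_ hd'
    · rw [Finsupp.mem_support_iff] at hi ⊢
      rw [Finsupp.add_apply]
      omega
    · rw [hd, Finsupp.single_add, ← add_assoc] at h
      rw [hd', add_right_comm]
      rcases (hc j hj).lt_or_eq with hlt | rfl
      · exact hB.move hlt h
      · exact h

theorem IsStableComplement.cone_initSeg_subset {B : Set (Fin n →₀ ℕ)} (hB : IsStableComplement B)
    {i : ℕ} (hi : i ≤ n) {a : Fin n →₀ ℕ} (h : cone a (singleIdx n i) ⊆ B) :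
    cone a (initSeg n i) ⊆ B := by
  rcases i with _ | i
  · rw [initSeg_zero]
    rintro _ ⟨c, hc, rfl⟩
    exact h ⟨c, fun j hj => absurd (hc hj) (Set.notMem_empty j), rfl⟩
  · rintro _ ⟨c, hc, rfl⟩
    refine hB.add_mem (l := ⟨i, hi⟩) c (fun j hj => ?_) a (h ⟨_, fun j hj => ?_, rfl⟩)
    · exact Nat.le_of_succ_le_succ (hc hj)
    · rw [Finset.mem_singleton.1 (Finsupp.support_single_subset hj)]
      rfl

variable {k : Type*} [Field k] {M : Ideal (MvPolynomial (Fin n) k)}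

theorem isAdmissiblePair_cone_initSeg (hM : IsStableComplement (standardMonomials M))
    {i : ℕ} (hi : i ≤ n) {a : Fin n →₀ ℕ} (hsupp : ∀ j ∈ a.support, i + 1 ≤ (j : ℕ) + 1)
    (h : cone a (singleIdx n i) ⊆ standardMonomials M) :
    IsAdmissiblePair M (cone a (initSeg n i)) := by
  refine ⟨a, _, Set.disjoint_left.2 fun j hj hj' => ?_, rfl, hM.cone_initSeg_subset hi h⟩
  have h1 := hsupp j hj
  have h2 : (j : ℕ) + 1 ≤ i := hj'
  omega

/-- A cone with directions in `[i]` is contained in an admissible pair with directions `[i]`. -/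
theorem exists_cone_initSeg_supset (hM : IsStableComplement (standardMonomials M))
    {i : ℕ} (hi : i ≤ n) {b : Fin n →₀ ℕ} (h : cone b (singleIdx n i) ⊆ standardMonomials M) :
    ∃ a : Fin n →₀ ℕ, (∀ j ∈ a.support, i + 1 ≤ (j : ℕ) + 1) ∧
      cone a (initSeg n i) ⊆ standardMonomials M ∧
      ∀ σ ⊆ initSeg n i, cone b σ ⊆ cone a (initSeg n i) := by
  classical
  -- The witness is `b` with the variables of `[i]` removed; the removed part is absorbed by the
  -- directions.
  have hsplit := Finsupp.filter_add_filter_not b (fun j => j ∉ initSeg n i)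
  refine ⟨b.filter (fun j => j ∉ initSeg n i), fun j hj => ?_, ?_, ?_⟩
  · rw [Finsupp.support_filter, Finset.mem_filter] at hj
    have : ¬ (j : ℕ) + 1 ≤ i := hj.2
    omega
  · rintro _ ⟨c, hc, rfl⟩
    refine hM.mem_of_le (hM.cone_initSeg_subset hi h ⟨c, hc, rfl⟩) ?_
    conv_rhs => rw [← hsplit]
    rw [add_right_comm]
    exact le_self_add
  · rintro σ hσ _ ⟨c, hc, rfl⟩
    refine ⟨b.filter (fun j => ¬ j ∉ initSeg n i) + c, ?_, ?_⟩
    · intro j hj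
      rcases Finset.mem_union.1 (Finsupp.support_add hj) with hj | hj
      · rw [Finsupp.support_filter, Finset.mem_filter] at hj
        exact not_not.1 hj.2
      · exact hσ (hc hj)
    · rw [← add_assoc, hsplit]

theorem IsStandardPair.exists_monomialSet (hM : IsStableComplement (standardMonomials M))
    {P : Set (Fin n →₀ ℕ)} (hP : IsStandardPair M P) :
    ∃ i ≤ n, ∃ a ∈ monomialSet (standardMonomials M) i, P = cone a (initSeg n i) := by
  obtain ⟨⟨b, σ, -, rfl, hσB⟩, hmax⟩ := hP
  -- `i` is the largest index in `σ`, counted from one, and `0` if `σ` is empty.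
  obtain ⟨i, hi, hσi, hiB⟩ : ∃ i ≤ n, σ ⊆ initSeg n i ∧
      cone b (singleIdx n i) ⊆ standardMonomials M := by
    rcases σ.eq_empty_or_nonempty with rfl | hne
    · refine ⟨0, Nat.zero_le n, Set.empty_subset _, ?_⟩
      rintro _ ⟨c, hc, rfl⟩
      refine hσB ⟨c, fun j hj => ?_, rfl⟩
      exact absurd (hc hj) (Nat.succ_ne_zero _)
    · obtain ⟨l, hl, hmaxl⟩ := σ.toFinite.exists_maximal hne
      refine ⟨l + 1, l.2, fun j hj => ?_, ?_⟩
      · rcases le_total j l with h | h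
        · exact Nat.succ_le_succ h
        · exact Nat.succ_le_succ (hmaxl hj h)
      · rintro _ ⟨c, hc, rfl⟩
        refine hσB ⟨c, fun j hj => ?_, rfl⟩
        rwa [show j = l from Fin.ext (Nat.succ_injective (hc hj))]
  obtain ⟨a, ha, haB, hsub⟩ := exists_cone_initSeg_supset hM hi hiB
  have haB' : cone a (singleIdx n i) ⊆ standardMonomials M := by
    rintro _ ⟨c, hc, rfl⟩
    exact haB ⟨c, hc.trans singleIdx_subset_initSeg, rfl⟩
  have heq : cone b σ = cone a (initSeg n i) := Set.Subset.antisymm (hsub σ hσi)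
    (hmax (isAdmissiblePair_cone_initSeg hM hi ha haB') (hsub σ hσi))
  refine ⟨i, hi, a, ⟨ha, haB', fun hin hB => ?_⟩, heq⟩
  -- Otherwise a pair with directions `[i+1]` would contain the given one, and maximality would give
  -- `[i+1] ⊆ [i]`.
  obtain ⟨a', ha', haB'', hsub'⟩ := exists_cone_initSeg_supset hM hin hB
  have hle : cone b σ ⊆ cone a' (initSeg n (i + 1)) := by
    rw [heq]
    exact hsub' _ fun j hj => Nat.le_succ_of_le hj
  have hge := hmax (isAdmissiblePair_cone_initSeg hM hin ha' (by
    rintro _ ⟨c, hc, rfl⟩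
    exact haB'' ⟨c, hc.trans singleIdx_subset_initSeg, rfl⟩)) hle
  have h1 := subset_of_cone_subset_cone (heq ▸ hge : cone a' (initSeg n (i + 1)) ⊆ _)
  have h2 : (⟨i, hin⟩ : Fin n) ∈ initSeg n i := h1 (show i + 1 ≤ i + 1 from le_rfl)
  exact Nat.not_succ_le_self i h2

theorem isStandardPair_of_mem_monomialSet (hM : IsStableComplement (standardMonomials M))
    {i : ℕ} (hi : i ≤ n) {a : Fin n →₀ ℕ} (ha : a ∈ monomialSet (standardMonomials M) i) :
    IsStandardPair M (cone a (initSeg n i)) := by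
  obtain ⟨hsupp, hB, hnot⟩ := ha
  refine ⟨isAdmissiblePair_cone_initSeg hM hi hsupp hB, ?_⟩
  rintro _ ⟨b, σ, -, rfl, hσB⟩ hle
  obtain ⟨c, hc, hac⟩ := hle (self_mem_cone a _)
  -- A direction `l` outside `[i]` would put every `a * y^s`, with `y` the variable `X l`, among the
  -- standard monomials; by stability the same holds for `y_{i+1}`, against `hnot`.
  have hσ : σ ⊆ initSeg n i := by
    intro l hl
    by_contra hli
    have hli' : i ≤ l := by
      have : ¬ (l : ℕ) + 1 ≤ i := hli
      omega
    refine hnot (hli'.trans_lt l.2) ?_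
    rintro _ ⟨c', hc', rfl⟩
    refine hM.add_mem (l := l) c' (fun j hj => ?_) a (hσB ⟨c + Finsupp.single l c'.degree, ?_, ?_⟩)
    · have : (j : ℕ) + 1 = i + 1 := hc' hj
      exact Fin.le_def.2 (by omega)
    · intro j hj
      rcases Finset.mem_union.1 (Finsupp.support_add hj) with hj | hj
      · exact hc hj
      · rwa [Finset.mem_singleton.1 (Finsupp.support_single_subset hj)]
    · rw [hac, add_assoc]
  -- `c` divides `a`, which avoids the variables of `[i]`, but `c` involves only those.
  have hc0 : c = 0 := by
    ext j
    by_contra hj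
    have h1 : (j : ℕ) + 1 ≤ i := hσ (hc (Finsupp.mem_support_iff.2 hj))
    have h2 := hsupp j (by
      rw [Finsupp.mem_support_iff, hac, Finsupp.add_apply]
      exact fun h => hj (Nat.add_eq_zero_iff.1 h).2)
    omega
  rw [hc0, add_zero] at hac
  rw [hac]
  rintro _ ⟨d, hd, rfl⟩
  exact ⟨d, hd.trans hσ, rfl⟩

end StronglyStable

end StdPairs

theorem lemma3p3 {k : Type*} [Field k] [CharZero k] (n : ℕ)
    (I : Ideal (MvPolynomial (Fin n) k)) :
    (∃! G : Ideal (MvPolynomial (Fin n) k), StdPairs.IsGin I G) ∧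
    ∀ (G : Ideal (MvPolynomial (Fin n) k)) (U : Set (GL (Fin n) k)),
      StdPairs.IsGin I G → StdPairs.IsGenericLocus I U → ∀ u ∈ U,
        {P : Set (Fin n →₀ ℕ) | StdPairs.IsStandardPair G P} =
          {P : Set (Fin n →₀ ℕ) | ∃ i ≤ n,
            ∃ a ∈ StdPairs.monomialSet (StdPairs.basisMonomials (StdPairs.transform u I)) i,
              P = StdPairs.cone a (StdPairs.initSeg n i)} := by
  refine ⟨?_, fun G U hG hU u hu => ?_⟩
  · obtain ⟨G, hG⟩ := StdPairs.exists_isGin I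
    exact ⟨G, hG, fun G' hG' => hG'.unique hG⟩
  · have hstd : StdPairs.standardMonomials G =
        StdPairs.basisMonomials (StdPairs.transform u I) := by
      rw [← hG.initialIdeal_eq hU hu, StdPairs.standardMonomials_initialIdeal,
        StdPairs.basisMonomials_eq]
    have hstable : StdPairs.IsStableComplement (StdPairs.standardMonomials G) := by
      rw [hstd, StdPairs.basisMonomials_eq]
      exact ⟨fun hm hle hm' => hm (StdPairs.mem_leadSet_of_le hm' hle),
        fun hjl hm hm' => hm (hU.add_single_mem_leadSet hu hjl hm')⟩
    rw [← hstd]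
    ext P
    refine ⟨fun hP => StdPairs.IsStandardPair.exists_monomialSet hstable hP, ?_⟩
    rintro ⟨i, hi, a, ha, rfl⟩
    exact StdPairs.isStandardPair_of_mem_monomialSet hstable hi ha
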